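/- (Fourier features oracle.) Consider the state space $[0,1]^2$ (the rescaled states $s=(\theta,\dot\theta)$ of the inverted pendulum) and an action set $\mathcal A$ with three actions. For an integer $k\ge 1$, the Fourier features of degree $k$ are the $K=6k^2$ functions $$\phi_{\cos}^{\mathbf c,\mathbf a}(s,a)=\mathbb 1[\mathbf a=a]\cos(\pi\,\mathbf c\cdot s),\qquad \phi_{\sin}^{\mathbf c,\mathbf a}(s,a)=\mathbb 1[\mathbf a=a]\sin(\pi\,\mathbf c\cdot s),\qquad \mathbf c\in\{0,\dots,k-1\}^2,\ \mathbf a\in\mathcal A,$$ and $\Phi(s,a)\in\mathbb R^K$ is the vector of all of them. Suppose that states are described by $B\ge 1$ bits in total: $b_1$ bits for the first and $b_2$ bits for the second coordinate, $b_1+b_2=B$, read as the binary fractions $s=(x_1/2^{b_1},\,x_2/2^{b_2})$ with $0\le x_i<2^{b_i}$. Basis states $|s,a\rangle$ hold the bits of $x_1,x_2$ and the two-bit index of $a$; the feature index is held in one qubit for the kind (cos or sin), two registers of $\lceil\log_2 k\rceil$ qubits for $\mathbf c$, and two qubits for $\mathbf a$. For a nonzero real vector $v$ put $|v\rangle=\|v\|^{-1}\sum_j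 v_j|j\rangle$. A quantum circuit consists of elementary gates (arbitrary one-qubit unitaries and CNOT gates) and may use ancilla qubits, which start in $|0\rangle$ and must be returned to $|0\rangle$; its cost is the number of its gates plus the number of its ancillas. Claim: there are absolute constants $C$ and $p$ such that, for all $k\ge1$, $B\ge1$ and $b_1+b_2=B$, some quantum circuit of cost at most $C\,B\,(\log K)^p$ implements exactly the feature oracle $$\mathrm O_\Phi:\ |s,a\rangle|0\rangle\longmapsto|s,a\rangle|\Phi(s,a)\rangle\qquad\text{for all } B\text{-bit states } s \text{ and all actions } a .$$ That is, $\mathrm O_\Phi$ can be implemented with cost $\mathcal O(B\,\mathrm{polylog}\,K)$. -/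

import Mathlib

namespace FourierOracle

/-! ### Quantum circuits

A register of qubits is labelled by a type `W` of wires. A computational basis state is a bit
assignment `W → Bool`, and a (pure, not necessarily normalized) state is its vector of amplitudes. -/

/-- Vectors of amplitudes over the computational basis of the qubits labelled by `W`. -/
abbrev QState (W : Type) : Type := (W → Bool) → ℂ

open Classical in
/-- The computational basis state `|x⟩`. -/
noncomputable def ket {W : Type} (x : W → Bool) : QState W := Pi.single x 1

/-- Elementary gates: an arbitrary one-qubit unitary on one wire, or a controlled NOT with control
`c` and target `t`. -/
inductive Gate (W : Type) : Type
  | single (i : W) (u : Matrix.unitaryGroup Bool ℂ) : Gate W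
  | cnot (c t : W) (h : c ≠ t) : Gate W

/-- The action of a gate on a vector of amplitudes. -/
noncomputable def Gate.apply {W : Type} [DecidableEq W] : Gate W → QState W → QState W
  | .single i u, ψ => fun x =>
      ∑ b : Bool, (u : Matrix Bool Bool ℂ) (x i) b * ψ (Function.update x i b)
  | .cnot c t _, ψ => fun x => ψ (Function.update x t (xor (x t) (x c)))

/-- A circuit is a list of gates, the first gate of the list being applied first. -/
abbrev Circuit (W : Type) : Type := List (Gate W)

/-- The action of a circuit on a vector of amplitudes. -/
noncomputable def Circuit.run {W : Type} [DecidableEq W] (U : Circuit W) (ψ : QState W) :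
    QState W :=
  U.foldl (fun φ g => g.apply φ) ψ

/-! ### Fourier features -/

/-- The index set of the features: a kind (`false` for the cosine, `true` for the sine), a frequency
vector `c = (c₁, c₂) ∈ {0, …, k-1}²`, and one of the three actions. -/
abbrev FeatureIndex (k : ℕ) : Type := Bool × Fin k × Fin k × Fin 3

/-- The total number `K` of features. -/
def numFeatures (k : ℕ) : ℕ := Fintype.card (FeatureIndex k)

theorem numFeatures_eq (k : ℕ) : numFeatures k = 6 * k ^ 2 := by
  simp only [numFeatures, Fintype.card_prod, Fintype.card_fin, Fintype.card_bool]
  ring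

/-- The feature vector `Φ(s, a) ∈ ℝ^K` of a state `s = (θ, θ')` and an action `a`: its entries are
`𝟙[a' = a] cos (π c · s)` and `𝟙[a' = a] sin (π c · s)`. -/
noncomputable def features (k : ℕ) (s : ℝ × ℝ) (a : Fin 3) : EuclideanSpace ℝ (FeatureIndex k) :=
  WithLp.toLp 2 fun j =>
    let (kind, c₁, c₂, a') := j
    let z : ℝ := (c₁ : ℝ) * s.1 + (c₂ : ℝ) * s.2
    if a' = a then (if kind then Real.sin (Real.pi * z) else Real.cos (Real.pi * z)) else 0

/-! ### The registers and the feature oracle -/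

/-- The qubits of the oracle: a state register (`b₁` qubits for the first and `b₂` qubits for the
second coordinate), an action register, a feature register (one qubit for the kind, two registers of
`⌈log₂ k⌉` qubits for the frequency vector, one register for the action index) and `r` ancillas. -/
inductive Wire (b₁ b₂ k r : ℕ) : Type
  | state₁ (i : Fin b₁) : Wire b₁ b₂ k r
  | state₂ (i : Fin b₂) : Wire b₁ b₂ k r
  | action (i : Fin 2) : Wire b₁ b₂ k r
  | kind : Wire b₁ b₂ k r
  | freq₁ (i : Fin (Nat.clog 2 k)) : Wire b₁ b₂ k r
  | freq₂ (i : Fin (Nat.clog 2 k)) : Wire b₁ b₂ k r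
  | actionIndex (i : Fin 2) : Wire b₁ b₂ k r
  | ancilla (i : Fin r) : Wire b₁ b₂ k r
  deriving DecidableEq

/-- The bit assignment of `|x₁, x₂⟩ |a⟩ |t⟩ |c₁, c₂⟩ |a'⟩ |0^r⟩`, all numbers being written in
binary with bit `i` having weight `2 ^ i`. -/
def encode {b₁ b₂ k r : ℕ} (x₁ : Fin (2 ^ b₁)) (x₂ : Fin (2 ^ b₂)) (a : Fin 3)
    (t : Bool) (c₁ c₂ a' : ℕ) : Wire b₁ b₂ k r → Bool
  | .state₁ i => x₁.val.testBit i
  | .state₂ i => x₂.val.testBit i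
  | .action i => a.val.testBit i
  | .kind => t
  | .freq₁ i => c₁.testBit i
  | .freq₂ i => c₂.testBit i
  | .actionIndex i => a'.testBit i
  | .ancilla _ => false

/-- The state in `[0, 1]²` described by the `b₁ + b₂` bits of `x₁` and `x₂`, read as the binary
fractions `x₁ / 2 ^ b₁` and `x₂ / 2 ^ b₂`. -/
noncomputable def decodeState {b₁ b₂ : ℕ} (x₁ : Fin (2 ^ b₁)) (x₂ : Fin (2 ^ b₂)) : ℝ × ℝ :=
  ((x₁.val : ℝ) / 2 ^ b₁, (x₂.val : ℝ) / 2 ^ b₂)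

/-- The vector `|s, a⟩ |Φ(s, a)⟩ |0^r⟩`, where `|v⟩ = ‖v‖⁻¹ ∑ⱼ vⱼ |j⟩`. -/
noncomputable def oracleOutput {b₁ b₂ : ℕ} (k r : ℕ) (x₁ : Fin (2 ^ b₁)) (x₂ : Fin (2 ^ b₂))
    (a : Fin 3) : QState (Wire b₁ b₂ k r) :=
  let v := features k (decodeState x₁ x₂) a
  ∑ j : FeatureIndex k,
    ((v j / ‖v‖ : ℝ) : ℂ) • ket (encode x₁ x₂ a j.1 j.2.1 j.2.2.1 j.2.2.2)

/-- The circuit `U` implements the feature oracle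
`|s, a⟩ |0⟩ |0^r⟩ ↦ |s, a⟩ |Φ(s, a)⟩ |0^r⟩`. -/
def ImplementsOracle {b₁ b₂ k r : ℕ} (U : Circuit (Wire b₁ b₂ k r)) : Prop :=
  ∀ (x₁ : Fin (2 ^ b₁)) (x₂ : Fin (2 ^ b₂)) (a : Fin 3),
    U.run (ket (encode x₁ x₂ a false 0 0 0)) = oracleOutput k r x₁ x₂ a

/-- The feature oracle can be implemented with cost `T`, where the cost of a circuit is the number of
its elementary gates plus the number of its ancilla qubits. -/
def OracleHasCost (b₁ b₂ k T : ℕ) : Prop :=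
  ∃ (r : ℕ) (U : Circuit (Wire b₁ b₂ k r)), ImplementsOracle U ∧ U.length + r = T

end FourierOracle

/-! Since `cos² + sin² = 1`, `Φ(s, a)` has norm `k` for every `s` and `a` (`norm_features`), so the
target is uniform over `c`, with the kind qubit rotated from `|0⟩` by the angle `π c · s`, and with
`a` copied by two CNOTs.

The angle is bilinear in the bits of `c` and of `s`, and rotations of one qubit add their angles. It
therefore splits into one doubly controlled rotation per pair of bits (`RotCost.product`), about `B
log k` of them, each of constant cost (`RotCost.control_two`).

The uniform superposition over `c < k` is prepared exactly, from the top digit down. Each digit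
needs a fixed rotation and a correction applied only when the higher digits agree with those of `k -
1` (`exists_angle_step`). The correction is a multiply controlled rotation, of linear cost with
zeroed ancillas (`RotCost.control_list`). `kind_rotation_eq_oracleOutput` combines these steps. -/

namespace FourierOracle

open Function

/-! ### Rotations whose angle depends on other qubits -/

section Rotations

variable {W : Type}

/-- The state has no amplitude on basis states in which a wire of `Z` is set. -/
def VanishesOn (Z : Set W) (ψ : QState W) : Prop := ∀ x, ∀ z ∈ Z, x z = true → ψ x = 0

theorem VanishesOn.mono {Z Z' : Set W} {ψ : QState W} (h : VanishesOn Z ψ) (hs : Z' ⊆ Z) :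
    VanishesOn Z' ψ := fun x z hz hx => h x z (hs hz) hx

variable [DecidableEq W]

theorem Circuit.run_append (U V : Circuit W) (ψ : QState W) :
    Circuit.run (U ++ V) ψ = Circuit.run V (Circuit.run U ψ) := by
  simp [Circuit.run, List.foldl_append]

theorem Circuit.run_cons (g : Gate W) (V : Circuit W) (ψ : QState W) :
    Circuit.run (g :: V) ψ = Circuit.run V (g.apply ψ) := rfl

theorem Circuit.run_nil (ψ : QState W) : Circuit.run [] ψ = ψ := rfl

/-- The rotation of the wire `t` by an angle that depends on the values of the other wires. -/
noncomputable def rot (t : W) (f : (W → Bool) → ℝ) (ψ : QState W) : QState W := fun x =>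
  if x t then
    (Real.sin (f (update x t false)) : ℂ) * ψ (update x t false)
      + (Real.cos (f (update x t false)) : ℂ) * ψ (update x t true)
  else
    (Real.cos (f (update x t false)) : ℂ) * ψ (update x t false)
      - (Real.sin (f (update x t false)) : ℂ) * ψ (update x t true)

theorem rot_apply (t : W) (f : (W → Bool) → ℝ) (ψ : QState W) (x : W → Bool) :
    rot t f ψ x = if x t then
      (Real.sin (f (update x t false)) : ℂ) * ψ (update x t false)
        + (Real.cos (f (update x t false)) : ℂ) * ψ (update x t true)
    else
      (Real.cos (f (update x t false)) : ℂ) * ψ (update x t false)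
        - (Real.sin (f (update x t false)) : ℂ) * ψ (update x t true) := rfl

theorem rot_congr {t : W} {f g : (W → Bool) → ℝ} (h : ∀ x, x t = false → f x = g x)
    (ψ : QState W) : rot t f ψ = rot t g ψ := by
  funext x
  simp only [rot, h (update x t false) (by simp)]

theorem rot_rot (t : W) (f g : (W → Bool) → ℝ) (ψ : QState W) :
    rot t f (rot t g ψ) = rot t (fun x => g x + f x) ψ := by
  funext x
  simp only [rot, update_self, update_idem, Real.cos_add, Real.sin_add]
  push_cast
  cases x t <;> simp <;> ring

theorem rot_zero (t : W) (ψ : QState W) : rot t (fun _ => 0) ψ = ψ := by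
  funext x
  have h : update x t (x t) = x := update_eq_self t x
  simp only [rot]
  cases hx : x t <;> rw [hx] at h <;> simp [h]

/-- `1` on `false` and `-1` on `true`. -/
def bitSign (b : Bool) : ℝ := if b then -1 else 1

/-- Conjugating a plane rotation by the bit flip reverses its angle, and the flip occurs exactly
when `a` is set. -/
theorem rot_conj_cnot {a t : W} (h : a ≠ t) (f : (W → Bool) → ℝ) (ψ : QState W) :
    (Gate.cnot a t h).apply (rot t f ((Gate.cnot a t h).apply ψ))
      = rot t (fun x => bitSign (x a) * f x) ψ := by
  funext x
  simp only [rot, Gate.apply, update_self, update_idem, update_of_ne h, bitSign]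
  cases x t <;> cases x a <;> simp <;> ring

theorem exists_gate_rot (t : W) (θ : ℝ) :
    ∃ g : Gate W, ∀ ψ, g.apply ψ = rot t (fun _ => θ) ψ := by
  let M : Matrix Bool Bool ℂ := Matrix.of fun i j =>
    if i = j then (Real.cos θ : ℂ) else if i then (Real.sin θ : ℂ) else -(Real.sin θ : ℂ)
  have hcs : (Real.cos θ : ℂ) * Real.cos θ + (Real.sin θ : ℂ) * Real.sin θ = 1 := by
    have := Real.cos_sq_add_sin_sq θ
    norm_cast
    nlinarith
  have hM : M ∈ Matrix.unitaryGroup Bool ℂ := by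
    rw [Matrix.mem_unitaryGroup_iff]
    ext i j
    cases i <;> cases j <;>
      simp [Matrix.mul_apply, M, Matrix.star_apply,
        -Complex.ofReal_cos, -Complex.ofReal_sin, Complex.conj_ofReal] <;>
      first | ring1 | linear_combination hcs
  refine ⟨.single t ⟨M, hM⟩, fun ψ => ?_⟩
  funext x
  simp only [Gate.apply, rot, Fintype.sum_bool, M]
  cases x t <;> simp <;> ring

theorem VanishesOn.rot {Z : Set W} {ψ : QState W} (h : VanishesOn Z ψ) {t : W} (ht : t ∉ Z)
    (f : (W → Bool) → ℝ) : VanishesOn Z (rot t f ψ) := by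
  intro x z hz hx
  have hne : z ≠ t := fun e => ht (e ▸ hz)
  simp [FourierOracle.rot, h (update x t false) z hz (by rwa [update_of_ne hne]),
    h (update x t true) z hz (by rwa [update_of_ne hne])]

theorem VanishesOn.rot_apply {t : W} {ψ : QState W} (h : VanishesOn {t} ψ)
    (f : (W → Bool) → ℝ) (x : W → Bool) :
    FourierOracle.rot t f ψ x = ((if x t then Real.sin (f (update x t false))
      else Real.cos (f (update x t false)) : ℝ) : ℂ) * ψ (update x t false) := by
  have := h (update x t true) t rfl (by simp)
  simp only [FourierOracle.rot, this]
  cases x t <;> simp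

/-- A circuit of at most `n` gates rotates `t` by the angle `f`, provided that the wires in `Z`
are zero. -/
def RotCost (Z : Set W) (t : W) (f : (W → Bool) → ℝ) (n : ℕ) : Prop :=
  ∃ U : Circuit W, U.length ≤ n ∧ ∀ ψ, VanishesOn Z ψ → Circuit.run U ψ = rot t f ψ

theorem RotCost.weaken {Z Z' : Set W} {t : W} {f g : (W → Bool) → ℝ} {m n : ℕ}
    (h : RotCost Z t f m) (hZ : Z ⊆ Z') (hfg : ∀ x, f x = g x) (hmn : m ≤ n) :
    RotCost Z' t g n := by
  obtain ⟨U, hl, hU⟩ := h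
  obtain rfl : f = g := funext hfg
  exact ⟨U, hl.trans hmn, fun ψ hψ => hU ψ (hψ.mono hZ)⟩

theorem RotCost.add {Z : Set W} {t : W} {f g : (W → Bool) → ℝ} {m n : ℕ} (ht : t ∉ Z)
    (hf : RotCost Z t f m) (hg : RotCost Z t g n) : RotCost Z t (fun x => f x + g x) (m + n) := by
  obtain ⟨U, hl, hU⟩ := hf
  obtain ⟨V, hl', hV⟩ := hg
  refine ⟨U ++ V, by simp; omega, fun ψ hψ => ?_⟩
  rw [Circuit.run_append, hU ψ hψ, hV _ (hψ.rot ht f), rot_rot]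

theorem RotCost.const (t : W) (θ : ℝ) : RotCost ∅ t (fun _ => θ) 1 := by
  obtain ⟨g, hg⟩ := exists_gate_rot t θ
  exact ⟨[g], le_rfl, fun ψ _ => hg ψ⟩

theorem RotCost.sum {ι : Type} (t : W) (f : ι → (W → Bool) → ℝ) (c : ℕ) (s : Finset ι)
    (h : ∀ i ∈ s, RotCost ∅ t (f i) c) :
    RotCost ∅ t (fun x => ∑ i ∈ s, f i x) (s.card * c) := by
  classical
  induction s using Finset.induction_on with
  | empty => exact ⟨[], by simp, fun ψ _ => by simp [Circuit.run_nil, rot_zero]⟩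
  | insert i s hi ih =>
    refine ((h i (by simp)).add (by simp) (ih fun j hj => h j (by simp [hj]))).weaken le_rfl
      (fun x => by rw [Finset.sum_insert hi]) ?_
    rw [Finset.card_insert_of_notMem hi]
    exact le_of_eq (by ring)

theorem RotCost.sign_mul {a t : W} (h : a ≠ t) {f : (W → Bool) → ℝ} {n : ℕ}
    (hf : RotCost ∅ t f n) : RotCost ∅ t (fun x => bitSign (x a) * f x) (n + 2) := by
  obtain ⟨U, hl, hU⟩ := hf
  refine ⟨.cnot a t h :: (U ++ [.cnot a t h]), by simp; omega, fun ψ _ => ?_⟩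
  rw [Circuit.run_cons, Circuit.run_append, hU _ (by simp [VanishesOn]), Circuit.run_cons,
    Circuit.run_nil, rot_conj_cnot]

/-- With bits as signs `σ`, the indicator of the condition is `(1 + σ_p σ_a)(1 + σ_q σ_b) / 4`. Its
four terms cost `1 + 3 + 3 + 5 = 12` gates. -/
theorem RotCost.control_two {a b t : W} (ha : a ≠ t) (hb : b ≠ t) (p q : Bool) (α : ℝ) :
    RotCost ∅ t (fun x => if x a = p ∧ x b = q then α else 0) 12 := by
  have h0 := RotCost.const t (α / 4)
  have h1 := (RotCost.const t (bitSign p * (α / 4))).sign_mul ha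
  have h2 := (RotCost.const t (bitSign q * (α / 4))).sign_mul hb
  have h3 := ((RotCost.const t (bitSign p * bitSign q * (α / 4))).sign_mul ha).sign_mul hb
  have hn : t ∉ (∅ : Set W) := by simp
  refine (((h0.add hn h1).add hn h2).add hn h3).weaken le_rfl (fun x => ?_) (by norm_num)
  cases x a <;> cases x b <;> cases p <;> cases q <;> simp [bitSign] <;> ring

-- Rotation by `π / 2` takes `|0⟩` to `|1⟩` without a sign, so on a zero wire it records `h` as a
-- Toffoli gate would.
open Classical in
theorem rot_flag_apply {e : W} {h : (W → Bool) → Prop} (he : ∀ x b, h (update x e b) ↔ h x)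
    {ψ : QState W} (hψ : VanishesOn {e} ψ) (x : W → Bool) :
    rot e (fun x => if h x then Real.pi / 2 else 0) ψ x
      = if (x e = true ↔ h x) then ψ (update x e false) else 0 := by
  rw [hψ.rot_apply]
  simp only [he]
  by_cases hx : h x <;> cases x e <;> simp [hx]

open Classical in
/-- Computing the condition `h` into the zero wire `e`, rotating under the control of `e` and
uncomputing `h` rotates under the control of `h`. -/
theorem rot_conj_flag {e t : W} (het : e ≠ t) {h : (W → Bool) → Prop}
    (he : ∀ x b, h (update x e b) ↔ h x) (ht : ∀ x b, h (update x t b) ↔ h x)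
    {f g : (W → Bool) → ℝ} (hfe : ∀ x b, f (update x e b) = f x)
    (hfg : ∀ x, (x e = true ↔ h x) → g x = f x) {ψ : QState W} (hψ : VanishesOn {e} ψ) :
    rot e (fun x => if h x then -(Real.pi / 2) else 0)
        (rot t g (rot e (fun x => if h x then Real.pi / 2 else 0) ψ)) = rot t f ψ := by
  -- Once the flag is computed, only basis states with `e` equal to `h` have amplitude; there `g` is
  -- `f`. As `f` ignores `e` and `h` ignores `t`, the two rotations commute.
  have key : rot t g (rot e (fun x => if h x then Real.pi / 2 else 0) ψ)
      = rot e (fun x => if h x then Real.pi / 2 else 0) (rot t f ψ) := by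
    funext x
    rw [rot_flag_apply he (hψ.rot (by simpa using het.symm) f)]
    rw [rot_apply t g, rot_apply t f]
    simp only [rot_flag_apply he hψ, ht, update_of_ne het, update_of_ne het.symm]
    by_cases hx : (x e = true ↔ h x)
    · have h1 : g (update x t false) = f (update x t false) :=
        hfg _ (by rwa [update_of_ne het, ht])
      have h2 : f (update (update x e false) t false) = f (update x t false) := by
        rw [update_comm het, hfe]
      simp only [if_pos hx, h1, h2, update_comm het.symm]
    · simp [if_neg hx]
  rw [key, rot_rot]
  conv_rhs => rw [← rot_zero e (rot t f ψ)]
  refine rot_congr (fun x _ => ?_) _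
  split_ifs <;> simp

/-- The conditions on `e` and the head of `l` are merged into a fresh ancilla, which replaces `e` in
the induction. Computing and uncomputing it costs `2 * 12` gates per control. -/
theorem RotCost.control_list {t : W} (α : ℝ) (l : List (W × Bool)) :
    ∀ (e : W × Bool) (anc : List W), anc.Nodup → t ∉ anc → e.1 ∉ anc → e.1 ≠ t →
      (∀ q ∈ l, q.1 ∉ anc ∧ q.1 ≠ t) → l.length ≤ anc.length →
      RotCost {z | z ∈ anc} t (fun x => if x e.1 = e.2 ∧ ∀ q ∈ l, x q.1 = q.2 then α else 0)
        (12 + 24 * l.length) := by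
  induction l with
  | nil =>
    intro e anc _ _ _ he _ _
    exact (RotCost.control_two he he e.2 e.2 α).weaken (by simp) (by simp) (by simp)
  | cons b l ih =>
    intro e anc hnd hta hea het hl hlen
    cases anc with
    | nil => simp at hlen
    | cons z anc =>
      simp only [List.nodup_cons, List.mem_cons, not_or, List.length_cons] at hnd hta hea hlen
      have hb := hl b (by simp)
      simp only [List.mem_cons, not_or] at hb
      have hl' : ∀ q ∈ l, (q.1 ≠ z ∧ q.1 ∉ anc) ∧ q.1 ≠ t := fun q hq => by
        simpa using hl q (by simp [hq])
      have hzt : z ≠ t := Ne.symm hta.1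
      obtain ⟨U, hUl, hU⟩ := ih (z, true) anc hnd.2 hta.2 hnd.1 hzt
        (fun q hq => ⟨(hl' q hq).1.2, (hl' q hq).2⟩) (by omega)
      obtain ⟨V, hVl, hV⟩ := RotCost.control_two hea.1 hb.1.1 e.2 b.2 (Real.pi / 2)
      obtain ⟨V', hVl', hV'⟩ := RotCost.control_two hea.1 hb.1.1 e.2 b.2 (-(Real.pi / 2))
      refine ⟨V ++ (U ++ V'), by simp; omega, fun ψ hψ => ?_⟩
      rw [Circuit.run_append, Circuit.run_append, hV _ (by simp [VanishesOn]),
        hU _ ((hψ.mono (by intro y; simp; tauto)).rot (by simpa using hnd.1) _),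
        hV' _ (by simp [VanishesOn])]
      have hq : ∀ (x : W → Bool) (c : Bool), ∀ q ∈ l, update x z c q.1 = x q.1 :=
        fun x c q hq => update_of_ne (hl' q hq).1.1 _ _
      let f : (W → Bool) → ℝ := fun x => if x e.1 = e.2 ∧ ∀ q ∈ b :: l, x q.1 = q.2 then α else 0
      have hf : ∀ x c, f (update x z c) = f x := fun x c => by
        have : (∀ q ∈ l, update x z c q.1 = q.2) ↔ ∀ q ∈ l, x q.1 = q.2 :=
          forall₂_congr fun q h => by rw [hq x c q h]
        simp only [f, List.forall_mem_cons, update_of_ne hea.1, update_of_ne hb.1.1, this]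
      have main := rot_conj_flag (W := W) hzt (h := fun x => x e.1 = e.2 ∧ x b.1 = b.2)
        (fun x c => by simp [update_of_ne hea.1, update_of_ne hb.1.1])
        (fun x c => by simp [update_of_ne het, update_of_ne hb.2])
        (g := fun x => if x z = true ∧ ∀ q ∈ l, x q.1 = q.2 then α else 0) hf
        (fun x hx => by
          have hx' : x z = true ↔ x e.1 = e.2 ∧ x b.1 = b.2 := hx
          simp only [f, hx', List.forall_mem_cons, and_assoc])
        (hψ.mono (by intro y; simp; tauto))
      convert main

end Rotations

/-! ### Exact preparation of the uniform superposition over `c < k` -/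

section UniformSuperposition

/-- The number of `c < k` in the block `v, …, v + 2 ^ j - 1`. -/
def blockCount (k j v : ℕ) : ℕ := min (k - v) (2 ^ j)

theorem blockCount_succ (k j v : ℕ) :
    blockCount k (j + 1) v = blockCount k j v + blockCount k j (v + 2 ^ j) := by
  unfold blockCount
  rw [pow_succ]
  omega

/-- The argument of `√a + i √b` works. The product form also covers `a = b = 0`. -/
theorem exists_splitAngle (a b : ℕ) : ∃ θ : ℝ,
    Real.cos θ * √((a + b : ℕ) : ℝ) = √(a : ℝ) ∧ Real.sin θ * √((a + b : ℕ) : ℝ) = √(b : ℝ) := by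
  let z : ℂ := ⟨√(a : ℝ), √(b : ℝ)⟩
  have hz : ‖z‖ = √((a + b : ℕ) : ℝ) := by
    rw [Complex.norm_def, Complex.normSq_apply]
    simp [z]
  refine ⟨z.arg, ?_, ?_⟩
  · rw [mul_comm, ← hz]
    exact Complex.norm_mul_cos_arg z
  · rw [mul_comm, ← hz]
    exact Complex.norm_mul_sin_arg z

variable {W : Type} {n : ℕ}

/-- The number whose binary digits are held by the wires `w`. -/
def regVal (w : Fin n → W) (x : W → Bool) : ℕ := Nat.ofBits fun i => x (w i)

theorem regVal_lt (w : Fin n → W) (x : W → Bool) : regVal w x < 2 ^ n := Nat.ofBits_lt_two_pow _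

theorem testBit_regVal (w : Fin n → W) (x : W → Bool) (i : Fin n) :
    (regVal w x).testBit i = x (w i) := Nat.testBit_ofBits_lt _ _ i.2

theorem regVal_eq_sum (w : Fin n → W) (x : W → Bool) :
    regVal w x = ∑ i, if x (w i) then 2 ^ (i : ℕ) else 0 := by
  unfold regVal
  induction n with
  | zero => simp
  | succ n ih =>
    rw [Nat.ofBits_succ, Fin.sum_univ_succ, add_comm]
    have := ih (fun i => w i.succ)
    simp only [Function.comp_def, this, Finset.mul_sum]
    congr 1
    · cases x (w 0) <;> simp
    · refine Finset.sum_congr rfl fun i _ => ?_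
      split_ifs <;> simp [pow_succ, mul_comm]

theorem dvd_regVal {w : Fin n → W} {x : W → Bool} {j : ℕ}
    (h : ∀ i : Fin n, (i : ℕ) < j → x (w i) = false) : 2 ^ j ∣ regVal w x := by
  rw [regVal_eq_sum]
  refine Finset.dvd_sum fun i _ => ?_
  by_cases hi : (i : ℕ) < j
  · simp [h i hi]
  · split_ifs
    · exact pow_dvd_pow 2 (by omega)
    · simp

theorem div_regVal_eq_iff (w : Fin n → W) (x : W → Bool) {m : ℕ} (hm : m < 2 ^ n) (j : ℕ) :
    regVal w x / 2 ^ j = m / 2 ^ j ↔ ∀ i : Fin n, j ≤ (i : ℕ) → x (w i) = m.testBit i := by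
  constructor
  · intro h i hi
    have := congrArg (fun a => Nat.testBit a (i - j)) h
    simp only [Nat.testBit_div_two_pow, Nat.sub_add_cancel hi, testBit_regVal] at this
    exact this
  · intro h
    refine Nat.eq_of_testBit_eq fun i => ?_
    rw [Nat.testBit_div_two_pow, Nat.testBit_div_two_pow]
    by_cases hi : i + j < n
    · exact (testBit_regVal w x ⟨i + j, hi⟩).trans (h ⟨i + j, hi⟩ (by simp))
    · have hp : 2 ^ n ≤ 2 ^ (i + j) := Nat.pow_le_pow_right (by norm_num) (by omega)
      rw [Nat.testBit_lt_two_pow ((regVal_lt w x).trans_le hp),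
        Nat.testBit_lt_two_pow (hm.trans_le hp)]

variable [DecidableEq W]

theorem regVal_update_false {w : Fin n → W} (hw : Injective w) {x : W → Bool} {j : Fin n}
    (hx : x (w j) = true) : regVal w x = regVal w (update x (w j) false) + 2 ^ (j : ℕ) := by
  rw [regVal_eq_sum, regVal_eq_sum, Fintype.sum_eq_add_sum_compl j,
    Fintype.sum_eq_add_sum_compl j (fun i => if update x (w j) false (w i) then _ else _)]
  simp only [hx, update_self, if_true, Bool.false_eq_true, if_false, zero_add]
  rw [add_comm]
  congr 1
  refine Finset.sum_congr rfl fun i hi => ?_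
  have : i ≠ j := by simpa using hi
  rw [update_of_ne (hw.ne this)]

open Classical in
/-- Reset the wires `w` to zero. -/
noncomputable def clear (w : Fin n → W) (x : W → Bool) : W → Bool :=
  fun v => if ∃ i, w i = v then false else x v

theorem clear_apply_of_ne {w : Fin n → W} {v : W} (h : ∀ i, w i ≠ v) (x : W → Bool) :
    clear w x v = x v := by
  simp [clear, h]

theorem clear_update (w : Fin n → W) (x : W → Bool) (j : Fin n) (b : Bool) :
    clear w (update x (w j) b) = clear w x := by
  funext v
  unfold clear
  split_ifs with h
  · rfl
  · exact update_of_ne (fun e => h ⟨j, e.symm⟩) _ _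

theorem clear_eq_self {w : Fin n → W} {x : W → Bool} (h : ∀ i, x (w i) = false) :
    clear w x = x := by
  funext v
  unfold clear
  split_ifs with hv
  · obtain ⟨i, rfl⟩ := hv
    exact (h i).symm
  · rfl

open Classical in
/-- The state of the preparation of `∑ c < k, |c⟩ / √k` in the wires `w` (tensored with `ψ`) in
which the digits `≥ j` have been prepared. -/
noncomputable def partialUniform (k : ℕ) (w : Fin n → W) (j : ℕ) (ψ : QState W) : QState W :=
  fun x => if ∀ i : Fin n, (i : ℕ) < j → x (w i) = false then
    ((√(blockCount k j (regVal w x) : ℝ) / √(k : ℝ) : ℝ) : ℂ) * ψ (clear w x) else 0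

theorem partialUniform_top {k : ℕ} (hk : 1 ≤ k) (hn : k ≤ 2 ^ n) (w : Fin n → W) {ψ : QState W}
    (hψ : VanishesOn (Set.range w) ψ) : partialUniform k w n ψ = ψ := by
  funext x
  unfold partialUniform
  split_ifs with h
  · have h' : ∀ i, x (w i) = false := fun i => h i i.2
    have h0 : regVal w x = 0 := by simp [regVal_eq_sum, h']
    have hk' : √(k : ℝ) ≠ 0 := by
      rw [Real.sqrt_ne_zero']
      exact_mod_cast hk
    rw [clear_eq_self h', h0, blockCount, Nat.sub_zero, min_eq_left hn, div_self hk']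
    simp
  · push Not at h
    obtain ⟨i, _, hi⟩ := h
    exact (hψ x (w i) ⟨i, rfl⟩ (by simpa using hi)).symm

theorem VanishesOn.partialUniform {Z : Set W} {ψ : QState W} (hψ : VanishesOn Z ψ) {w : Fin n → W}
    (hZ : ∀ i, w i ∉ Z) (k j : ℕ) : VanishesOn Z (partialUniform k w j ψ) := by
  intro x z hz hx
  have : ψ (clear w x) = 0 := hψ _ z hz (by
    rwa [clear_apply_of_ne (fun i (e : w i = z) => hZ i (e ▸ hz))])
  simp [FourierOracle.partialUniform, this]

-- Digit `j` splits each block of length `2 ^ (j + 1)` in proportion to the counts of `c < k` in its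
-- halves. Only the block containing `k - 1` can be cut unevenly, so two angles suffice.
open Classical in
theorem exists_angle_step {k : ℕ} (hk : 1 ≤ k) (hn : k ≤ 2 ^ n) {w : Fin n → W}
    (hw : Injective w) (j : Fin n) : ∃ α β : ℝ, ∀ ψ : QState W,
      rot (w j) (fun x => α + if ∀ i : Fin n, (j : ℕ) + 1 ≤ (i : ℕ) →
        x (w i) = (k - 1).testBit i then β else 0) (partialUniform k w (j + 1) ψ)
      = partialUniform k w j ψ := by
  -- `u` is the start of the block containing `k - 1`; `α` below halves a full block and `γ` splits
  -- this one.
  set u : ℕ := (k - 1) / 2 ^ ((j : ℕ) + 1) * 2 ^ ((j : ℕ) + 1) with hu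
  obtain ⟨α, hα, hα'⟩ := exists_splitAngle (2 ^ (j : ℕ)) (2 ^ (j : ℕ))
  obtain ⟨γ, hγ, hγ'⟩ := exists_splitAngle (blockCount k j u) (blockCount k j (u + 2 ^ (j : ℕ)))
  rw [← blockCount_succ] at hγ hγ'
  refine ⟨α, γ - α, fun ψ => ?_⟩
  have hvan : VanishesOn {w j} (partialUniform k w (j + 1) ψ) := by
    rintro x z rfl hx
    refine if_neg fun h => ?_
    simp [h j (by simp)] at hx
  funext x
  rw [hvan.rot_apply]
  simp only [← div_regVal_eq_iff w _ (show k - 1 < 2 ^ n by omega)]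
  have hlow : (∀ i : Fin n, (i : ℕ) < j + 1 → update x (w j) false (w i) = false) ↔
      ∀ i : Fin n, (i : ℕ) < j → x (w i) = false := by
    refine ⟨fun h i hi => ?_, fun h i hi => ?_⟩
    · have := h i (by omega)
      rwa [update_of_ne (hw.ne (by rintro rfl; omega))] at this
    · by_cases hij : i = j
      · simp [hij]
      · rw [update_of_ne (hw.ne hij)]
        exact h i (by have := Fin.val_ne_of_ne hij; omega)
  unfold partialUniform
  rw [clear_update]
  by_cases hx : ∀ i : Fin n, (i : ℕ) < j → x (w i) = false
  swap
  · rw [if_neg hx, if_neg (mt hlow.1 hx), mul_zero]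
  rw [if_pos hx, if_pos (hlow.2 hx)]
  have hdvd := dvd_regVal (hlow.2 hx)
  set v := regVal w (update x (w j) false) with hv
  set f : ℝ := α + if v / 2 ^ ((j : ℕ) + 1) = (k - 1) / 2 ^ ((j : ℕ) + 1) then γ - α else 0 with hf
  have hangle : Real.cos f * √(blockCount k (j + 1) v : ℝ) = √(blockCount k j v : ℝ) ∧
      Real.sin f * √(blockCount k (j + 1) v : ℝ) = √(blockCount k j (v + 2 ^ (j : ℕ)) : ℝ) := by
    obtain ⟨q, hq⟩ := hdvd
    have hP : 0 < 2 ^ ((j : ℕ) + 1) := by positivity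
    have hPj : 2 ^ ((j : ℕ) + 1) = 2 * 2 ^ (j : ℕ) := by ring
    have hdiv : v / 2 ^ ((j : ℕ) + 1) = q := by rw [hq, Nat.mul_div_cancel_left _ hP]
    have hlo := Nat.div_mul_le_self (k - 1) (2 ^ ((j : ℕ) + 1))
    have hhi := Nat.lt_div_mul_add (a := k - 1) hP
    rw [← hu] at hlo hhi
    -- Blocks before `u` are full; blocks after it are empty and carry no amplitude, so any angle
    -- serves them.
    rcases lt_trichotomy q ((k - 1) / 2 ^ ((j : ℕ) + 1)) with h | h | h
    · rw [hf, if_neg (by rw [hdiv]; exact h.ne), add_zero]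
      have h1 : v + 2 ^ ((j : ℕ) + 1) ≤ u := by
        have := Nat.mul_le_mul_right (2 ^ ((j : ℕ) + 1)) (Nat.succ_le_of_lt h)
        rw [Nat.succ_mul, mul_comm q, ← hq] at this
        exact this
      have e1 : blockCount k j v = 2 ^ (j : ℕ) := by unfold blockCount; omega
      have e2 : blockCount k j (v + 2 ^ (j : ℕ)) = 2 ^ (j : ℕ) := by unfold blockCount; omega
      rw [blockCount_succ, e1, e2]
      exact ⟨hα, hα'⟩
    · rw [hf, if_pos (by rw [hdiv, h])]
      have : v = u := by rw [hq, hu, h, mul_comm]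
      rw [this, add_sub_cancel]
      exact ⟨hγ, hγ'⟩
    · have h1 : u + 2 ^ ((j : ℕ) + 1) ≤ v := by
        have := Nat.mul_le_mul_right (2 ^ ((j : ℕ) + 1)) (Nat.succ_le_of_lt h)
        rw [Nat.succ_mul, mul_comm q, ← hq] at this
        exact this
      have e1 : blockCount k j v = 0 := by unfold blockCount; omega
      have e2 : blockCount k j (v + 2 ^ (j : ℕ)) = 0 := by unfold blockCount; omega
      rw [blockCount_succ, e1, e2]
      simp
  rw [← mul_assoc, ← Complex.ofReal_mul, ← mul_div_assoc]
  congr 4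
  cases hxj : x (w j)
  · have : update x (w j) false = x := by rw [← hxj, update_eq_self]
    rw [this] at hv
    simpa [← hv] using hangle.1
  · rw [regVal_update_false hw hxj, ← hv]
    simpa using hangle.2

theorem RotCost.control_digits {w : Fin n → W} (hw : Injective w) {anc : List W} (hnd : anc.Nodup)
    (hlen : n ≤ anc.length) (hanc : ∀ i, w i ∉ anc) (j : Fin n) (m : ℕ) (β : ℝ) :
    RotCost {z | z ∈ anc} (w j) (fun x => if ∀ i : Fin n, (j : ℕ) + 1 ≤ (i : ℕ) →
      x (w i) = m.testBit i then β else 0) (12 + 24 * n) := by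
  set l : List (W × Bool) := (((List.finRange n).filter fun i : Fin n => (j : ℕ) + 1 ≤ (i : ℕ)).map
    fun i => (w i, m.testBit i)) with hl
  have hmem : ∀ q ∈ l, q.1 ∉ anc ∧ q.1 ≠ w j := by
    intro q hq
    simp only [hl, List.mem_map, List.mem_filter, decide_eq_true_eq] at hq
    obtain ⟨i, ⟨_, hi⟩, rfl⟩ := hq
    exact ⟨hanc i, hw.ne (by rintro rfl; omega)⟩
  have hlen' : l.length ≤ n := by
    rw [hl, List.length_map]
    exact (List.length_filter_le _ _).trans (by simp)
  have hcond : ∀ x : W → Bool, (∀ q ∈ l, x q.1 = q.2) ↔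
      ∀ i : Fin n, (j : ℕ) + 1 ≤ (i : ℕ) → x (w i) = m.testBit i := by
    intro x
    simp [hl]
  simp only [← hcond]
  clear_value l
  -- The top digit has no higher digits, so its correction is unconditional.
  cases l with
  | nil => exact (RotCost.const (w j) β).weaken (by simp) (by simp) (by omega)
  | cons e l =>
    have hcons : ∀ x : W → Bool, (if x e.1 = e.2 ∧ ∀ q ∈ l, x q.1 = q.2 then β else 0)
        = if ∀ q ∈ e :: l, x q.1 = q.2 then β else 0 := fun x => by
      simp only [List.forall_mem_cons]
    have h' : l.length + 1 ≤ n := by simpa using hlen'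
    refine (RotCost.control_list β l e anc hnd (hanc j) (hmem e (by simp)).1 (hmem e (by simp)).2
      (fun q hq => hmem q (by simp [hq])) (by omega)).weaken le_rfl hcons (by omega)

/-- `d` counts the digits prepared, from the most significant. Each costs one gate for `α` and `12 +
24 * n` for the correction. -/
theorem exists_circuit_partialUniform {k : ℕ} (hk : 1 ≤ k) (hn : k ≤ 2 ^ n) {w : Fin n → W}
    (hw : Injective w) {anc : List W} (hnd : anc.Nodup) (hlen : n ≤ anc.length)
    (hanc : ∀ i, w i ∉ anc) (d : ℕ) (hd : d ≤ n) :
    ∃ U : Circuit W, U.length ≤ d * (13 + 24 * n) ∧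
      ∀ ψ, VanishesOn {z | z ∈ anc} ψ → VanishesOn (Set.range w) ψ →
        Circuit.run U ψ = partialUniform k w (n - d) ψ := by
  induction d with
  | zero => exact ⟨[], by simp, fun ψ _ h => (partialUniform_top hk hn w h).symm⟩
  | succ d ih =>
    obtain ⟨U, hUl, hU⟩ := ih (by omega)
    obtain ⟨α, β, h⟩ := exists_angle_step hk hn hw ⟨n - (d + 1), by omega⟩
    obtain ⟨V, hVl, hV⟩ := RotCost.add (Z := {z | z ∈ anc}) (hanc ⟨n - (d + 1), by omega⟩)
      ((RotCost.const _ α).weaken (Set.empty_subset _) (fun _ => rfl) le_rfl)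
      (RotCost.control_digits hw hnd hlen hanc ⟨n - (d + 1), by omega⟩ (k - 1) β)
    refine ⟨U ++ V, by rw [List.length_append, Nat.succ_mul]; omega, fun ψ hψ hψ' => ?_⟩
    rw [Circuit.run_append, hU ψ hψ hψ', hV _ (hψ.partialUniform hanc _ _), ← h ψ]
    have : n - d = n - (d + 1) + 1 := by omega
    rw [this]

theorem partialUniform_zero (k : ℕ) (w : Fin n → W) (ψ : QState W) (x : W → Bool) :
    partialUniform k w 0 ψ x
      = if regVal w x < k then ((1 / √(k : ℝ) : ℝ) : ℂ) * ψ (clear w x) else 0 := by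
  rw [partialUniform, if_pos (by simp)]
  split_ifs with h
  · have : blockCount k 0 (regVal w x) = 1 := by unfold blockCount; rw [pow_zero]; omega
    simp [this]
  · have : blockCount k 0 (regVal w x) = 0 := by unfold blockCount; omega
    simp [this]

end UniformSuperposition

/-! ### The feature oracle and its cost -/

section Oracle

/-- Expanding both numbers in binary gives one doubly controlled rotation per pair of bits. The
factor `b` is the source of the linear dependence on `B`. -/
theorem RotCost.product {W : Type} [DecidableEq W] {n b : ℕ} {t : W} {u : Fin n → W}
    {s : Fin b → W} (hu : ∀ i, u i ≠ t) (hs : ∀ i, s i ≠ t) (γ : ℝ) :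
    RotCost ∅ t (fun x => γ * ((regVal u x : ℝ) * (regVal s x : ℝ))) (n * b * 12) := by
  refine (RotCost.sum t (fun (p : Fin n × Fin b) x => if x (u p.1) = true ∧ x (s p.2) = true then
    γ * ((2 : ℝ) ^ (p.1 : ℕ) * 2 ^ (p.2 : ℕ)) else 0) 12 Finset.univ
    fun p _ => RotCost.control_two (hu p.1) (hs p.2) true true _).weaken le_rfl (fun x => ?_)
    (by simp)
  rw [regVal_eq_sum, regVal_eq_sum, Nat.cast_sum, Nat.cast_sum, Finset.sum_mul_sum,
    ← Finset.sum_product', Finset.mul_sum, Finset.univ_product_univ]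
  refine Finset.sum_congr rfl fun p _ => ?_
  cases x (u p.1) <;> cases x (s p.2) <;> simp

open Classical in
theorem ket_apply {W : Type} (x y : W → Bool) : ket x y = if y = x then 1 else 0 :=
  Pi.single_apply _ _ _

theorem Gate.cnot_apply_ket {W : Type} [DecidableEq W] {c t : W} (h : c ≠ t) (x : W → Bool) :
    (Gate.cnot c t h).apply (ket x) = ket (update x t (xor (x t) (x c))) := by
  funext y
  have : update y t (xor (y t) (y c)) = x ↔ y = update x t (xor (x t) (x c)) := by
    constructor
    · rintro rfl
      simp [update_of_ne h]
    · rintro rfl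
      simp [update_of_ne h]
  change ket x (update y t (xor (y t) (y c))) = _
  rw [ket_apply, ket_apply]
  by_cases hy : y = update x t (xor (x t) (x c))
  · rw [if_pos hy, if_pos (this.2 hy)]
  · rw [if_neg hy, if_neg (mt this.1 hy)]

theorem norm_features (k : ℕ) (s : ℝ × ℝ) (a : Fin 3) : ‖features k s a‖ = k := by
  rw [EuclideanSpace.norm_eq, Real.sqrt_eq_iff_mul_self_eq (by positivity) (by positivity)]
  simp only [Fintype.sum_prod_type, features, Fintype.sum_bool, Real.norm_eq_abs, sq_abs, ite_pow,
    ne_eq, OfNat.ofNat_ne_zero, not_false_eq_true, zero_pow, Finset.sum_ite_eq', Finset.mem_univ,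
    if_true, Bool.false_eq_true, if_false, ← Finset.sum_add_distrib, Real.sin_sq_add_cos_sq,
    Finset.sum_const, Finset.card_univ, Fintype.card_fin, nsmul_eq_mul, mul_one]

variable {b₁ b₂ k r : ℕ}

theorem regVal_encode_freq₁ (x₁ : Fin (2 ^ b₁)) (x₂ : Fin (2 ^ b₂)) (a : Fin 3) (t : Bool)
    {c₁ : ℕ} (hc : c₁ < k) (c₂ a' : ℕ) :
    regVal Wire.freq₁ (encode x₁ x₂ a t c₁ c₂ a' : Wire b₁ b₂ k r → Bool) = c₁ :=
  (Nat.ofBits_testBit c₁ _).trans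
    (Nat.mod_eq_of_lt (hc.trans_le (Nat.le_pow_clog one_lt_two k)))

theorem regVal_encode_freq₂ (x₁ : Fin (2 ^ b₁)) (x₂ : Fin (2 ^ b₂)) (a : Fin 3) (t : Bool)
    (c₁ : ℕ) {c₂ : ℕ} (hc : c₂ < k) (a' : ℕ) :
    regVal Wire.freq₂ (encode x₁ x₂ a t c₁ c₂ a' : Wire b₁ b₂ k r → Bool) = c₂ :=
  (Nat.ofBits_testBit c₂ _).trans
    (Nat.mod_eq_of_lt (hc.trans_le (Nat.le_pow_clog one_lt_two k)))

theorem regVal_encode_state₁ (x₁ : Fin (2 ^ b₁)) (x₂ : Fin (2 ^ b₂)) (a : Fin 3) (t : Bool)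
    (c₁ c₂ a' : ℕ) :
    regVal Wire.state₁ (encode x₁ x₂ a t c₁ c₂ a' : Wire b₁ b₂ k r → Bool) = x₁ :=
  (Nat.ofBits_testBit _ _).trans (Nat.mod_eq_of_lt x₁.2)

theorem regVal_encode_state₂ (x₁ : Fin (2 ^ b₁)) (x₂ : Fin (2 ^ b₂)) (a : Fin 3) (t : Bool)
    (c₁ c₂ a' : ℕ) :
    regVal Wire.state₂ (encode x₁ x₂ a t c₁ c₂ a' : Wire b₁ b₂ k r → Bool) = x₂ :=
  (Nat.ofBits_testBit _ _).trans (Nat.mod_eq_of_lt x₂.2)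

/-- The angle `π c · s` read off the frequency and state registers. -/
noncomputable def phase (x : Wire b₁ b₂ k r → Bool) : ℝ :=
  Real.pi / 2 ^ b₁ * ((regVal Wire.freq₁ x : ℝ) * (regVal Wire.state₁ x : ℝ))
    + Real.pi / 2 ^ b₂ * ((regVal Wire.freq₂ x : ℝ) * (regVal Wire.state₂ x : ℝ))

theorem oracleOutput_encode (x₁ : Fin (2 ^ b₁)) (x₂ : Fin (2 ^ b₂)) (a : Fin 3) (t : Bool)
    (c₁ c₂ : Fin k) :
    oracleOutput k r x₁ x₂ a (encode x₁ x₂ a t c₁ c₂ a)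
      = (((if t then Real.sin (phase (encode x₁ x₂ a t c₁ c₂ a : Wire b₁ b₂ k r → Bool))
        else Real.cos (phase (encode x₁ x₂ a t c₁ c₂ a : Wire b₁ b₂ k r → Bool))) / k : ℝ) : ℂ) := by
  simp only [oracleOutput, Finset.sum_apply, Pi.smul_apply, smul_eq_mul, norm_features]
  rw [Fintype.sum_eq_single (t, c₁, c₂, a)]
  · simp only [ket_apply, if_true, mul_one, features, phase, decodeState,
      regVal_encode_freq₁ _ _ _ _ c₁.2, regVal_encode_freq₂ _ _ _ _ _ c₂.2, regVal_encode_state₁,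
      regVal_encode_state₂]
    congr 4 <;> ring
  · rintro ⟨t', c₁', c₂', a'⟩ hne
    by_cases ha : a' = a
    · subst ha
      rw [ket_apply, if_neg, mul_zero]
      intro h
      refine hne ?_
      have h1 := congrFun h Wire.kind
      have h2 := congrArg (regVal Wire.freq₁) h
      have h3 := congrArg (regVal Wire.freq₂) h
      rw [regVal_encode_freq₁ _ _ _ _ c₁.2, regVal_encode_freq₁ _ _ _ _ c₁'.2] at h2
      rw [regVal_encode_freq₂ _ _ _ _ _ c₂.2, regVal_encode_freq₂ _ _ _ _ _ c₂'.2] at h3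
      have h1 : t = t' := h1
      rw [h1, Fin.ext h2, Fin.ext h3]
    · simp [features, ha]

theorem oracleOutput_eq_zero (x₁ : Fin (2 ^ b₁)) (x₂ : Fin (2 ^ b₂)) (a : Fin 3)
    {x : Wire b₁ b₂ k r → Bool}
    (h : ∀ (t : Bool) (c₁ c₂ : Fin k), x ≠ encode x₁ x₂ a t c₁ c₂ a) :
    oracleOutput k r x₁ x₂ a x = 0 := by
  simp only [oracleOutput, Finset.sum_apply, Pi.smul_apply, smul_eq_mul]
  refine Finset.sum_eq_zero ?_
  rintro ⟨t, c₁, c₂, a'⟩ -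
  by_cases ha : a' = a
  · subst ha
    rw [ket_apply, if_neg (h t c₁ c₂), mul_zero]
  · simp [features, ha]

theorem clear_freq_eq_encode_iff (x₁ : Fin (2 ^ b₁)) (x₂ : Fin (2 ^ b₂)) (a : Fin 3)
    (x : Wire b₁ b₂ k r → Bool) :
    clear Wire.freq₁ (clear Wire.freq₂ (update x Wire.kind false))
        = encode x₁ x₂ a false 0 0 a
      ↔ x = encode x₁ x₂ a (x Wire.kind) (regVal Wire.freq₁ x) (regVal Wire.freq₂ x) a := by
  constructor
  · intro h
    funext v
    have hv := congrFun h v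
    cases v <;>
      first
      | rfl
      | exact (testBit_regVal _ _ _).symm
      | simpa [clear, encode] using hv
  · intro h
    funext v
    have hv := congrFun h v
    cases v <;> first | (simp [clear, encode]; done) | simpa [clear, encode] using hv

/-- The two preparations give `1 / √k` each, matching the norm `k`; the rotation supplies the cosine
or sine. Register values `≥ k` have amplitude zero on both sides. -/
theorem kind_rotation_eq_oracleOutput (hk : 1 ≤ k) (x₁ : Fin (2 ^ b₁)) (x₂ : Fin (2 ^ b₂))
    (a : Fin 3) :
    rot Wire.kind phase (partialUniform k Wire.freq₂ 0 (partialUniform k Wire.freq₁ 0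
      (ket (encode x₁ x₂ a false 0 0 a)))) = oracleOutput k r x₁ x₂ a := by
  funext x
  have hket : VanishesOn {Wire.kind}
      (ket (encode x₁ x₂ a false 0 0 a : Wire b₁ b₂ k r → Bool)) := by
    rintro y z rfl hy
    rw [ket_apply, if_neg]
    rintro rfl
    simp [encode] at hy
  rw [((hket.partialUniform (by simp) _ _).partialUniform (by simp) _ _).rot_apply,
    partialUniform_zero, partialUniform_zero]
  have e1 : regVal Wire.freq₁ (clear Wire.freq₂ (update x Wire.kind false))
      = regVal Wire.freq₁ x := by
    simp [regVal, clear]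
  have e2 : regVal Wire.freq₂ (update x Wire.kind false) = regVal Wire.freq₂ x := by
    simp [regVal]
  have e3 : phase (update x Wire.kind false) = phase x := by
    simp [phase, regVal]
  rw [e1, e2, e3, ket_apply, clear_freq_eq_encode_iff]
  by_cases h2 : regVal Wire.freq₂ x < k
  swap
  · rw [if_neg h2, mul_zero, oracleOutput_eq_zero]
    rintro t c₁ c₂ rfl
    rw [regVal_encode_freq₂ _ _ _ _ _ c₂.2] at h2
    exact h2 c₂.2
  by_cases h1 : regVal Wire.freq₁ x < k
  swap
  · rw [if_neg h1, mul_zero, ite_self, mul_zero, oracleOutput_eq_zero]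
    rintro t c₁ c₂ rfl
    rw [regVal_encode_freq₁ _ _ _ _ c₁.2] at h1
    exact h1 c₁.2
  rw [if_pos h2, if_pos h1]
  by_cases hx : x = encode x₁ x₂ a (x Wire.kind) (regVal Wire.freq₁ x) (regVal Wire.freq₂ x) a
  · have := oracleOutput_encode (r := r) x₁ x₂ a (x Wire.kind) ⟨_, h1⟩ ⟨_, h2⟩
    rw [← hx] at this
    rw [this, if_pos hx, mul_one, ← Complex.ofReal_mul, ← Complex.ofReal_mul, one_div, ← mul_inv,
      Real.mul_self_sqrt (by positivity), div_eq_mul_inv]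
  · rw [if_neg hx, oracleOutput_eq_zero]
    · simp
    · rintro t c₁ c₂ rfl
      apply hx
      rw [regVal_encode_freq₁ _ _ _ _ c₁.2, regVal_encode_freq₂ _ _ _ _ _ c₂.2]
      rfl

theorem copy_action_encode (x₁ : Fin (2 ^ b₁)) (x₂ : Fin (2 ^ b₂)) (a : Fin 3) :
    (Gate.cnot (Wire.action 1) (Wire.actionIndex 1) (by simp)).apply
      ((Gate.cnot (Wire.action 0) (Wire.actionIndex 0) (by simp)).apply
        (ket (encode x₁ x₂ a false 0 0 0 : Wire b₁ b₂ k r → Bool)))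
      = ket (encode x₁ x₂ a false 0 0 a) := by
  rw [Gate.cnot_apply_ket, Gate.cnot_apply_ket]
  congr 1
  funext v
  cases v with
  | actionIndex i => fin_cases i <;> simp [encode]
  | _ => simp [encode]

/-- Both frequency registers use the same ancillas, which are zero again after the first
preparation. -/
theorem exists_oracle_circuit (hk : 1 ≤ k) :
    ∃ U : Circuit (Wire b₁ b₂ k (Nat.clog 2 k)), ImplementsOracle U ∧
      U.length ≤ 2 + 2 * (Nat.clog 2 k * (13 + 24 * Nat.clog 2 k))
        + 12 * (Nat.clog 2 k * (b₁ + b₂)) := by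
  set n := Nat.clog 2 k with hn
  have hkn : k ≤ 2 ^ n := Nat.le_pow_clog one_lt_two k
  let anc : List (Wire b₁ b₂ k n) := (List.finRange n).map Wire.ancilla
  have hnd : anc.Nodup := (List.nodup_finRange n).map fun i j h => by simpa using h
  have hlen : n ≤ anc.length := by simp [anc]
  obtain ⟨U₁, hl₁, hU₁⟩ := exists_circuit_partialUniform hk hkn (w := Wire.freq₁)
    (fun i j h => by simpa using h) hnd hlen (by simp [anc]) n le_rfl
  obtain ⟨U₂, hl₂, hU₂⟩ := exists_circuit_partialUniform hk hkn (w := Wire.freq₂)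
    (fun i j h => by simpa using h) hnd hlen (by simp [anc]) n le_rfl
  obtain ⟨V, hl, hV⟩ := (RotCost.product (W := Wire b₁ b₂ k n) (t := Wire.kind) (u := Wire.freq₁)
    (s := Wire.state₁) (by simp) (by simp) (Real.pi / 2 ^ b₁)).add (by simp)
    (RotCost.product (u := Wire.freq₂) (s := Wire.state₂) (by simp) (by simp) (Real.pi / 2 ^ b₂))
  refine ⟨.cnot (.action 0) (.actionIndex 0) (by simp) ::
    .cnot (.action 1) (.actionIndex 1) (by simp) :: (U₁ ++ (U₂ ++ V)), fun x₁ x₂ a => ?_, ?_⟩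
  · have hanc : VanishesOn {z | z ∈ anc}
        (ket (encode x₁ x₂ a false 0 0 a : Wire b₁ b₂ k n → Bool)) := by
      intro y z hz hy
      rw [ket_apply, if_neg]
      rintro rfl
      simp only [anc, List.mem_map, Set.mem_ofPred_eq] at hz
      obtain ⟨i, _, rfl⟩ := hz
      simp [encode] at hy
    have h₁ : VanishesOn (Set.range Wire.freq₁)
        (ket (encode x₁ x₂ a false 0 0 a : Wire b₁ b₂ k n → Bool)) := by
      rintro y z ⟨i, rfl⟩ hy
      rw [ket_apply, if_neg]
      rintro rfl
      simp [encode] at hy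
    have h₂ : VanishesOn (Set.range Wire.freq₂)
        (ket (encode x₁ x₂ a false 0 0 a : Wire b₁ b₂ k n → Bool)) := by
      rintro y z ⟨i, rfl⟩ hy
      rw [ket_apply, if_neg]
      rintro rfl
      simp [encode] at hy
    rw [Circuit.run_cons, Circuit.run_cons, copy_action_encode, Circuit.run_append,
      Circuit.run_append, hU₁ _ hanc h₁, hU₂ _ (hanc.partialUniform (by simp [anc]) _ _)
      (h₂.partialUniform (by simp) _ _), hV _ (by simp [VanishesOn]), Nat.sub_self]
    exact kind_rotation_eq_oracleOutput hk x₁ x₂ a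
  · simp only [List.length_cons, List.length_append]
    linarith [Nat.mul_add n b₁ b₂]

theorem clog_le_log_numFeatures (hk : 1 ≤ k) :
    1 ≤ Real.log (numFeatures k) ∧ (Nat.clog 2 k : ℝ) ≤ Real.log (numFeatures k) := by
  have hk' : (1 : ℝ) ≤ k := by exact_mod_cast hk
  have hlog : Real.log (numFeatures k) = Real.log 6 + 2 * Real.log k := by
    rw [numFeatures_eq, Nat.cast_mul, Nat.cast_pow, Real.log_mul (by norm_num) (by positivity),
      Real.log_pow]
    norm_num
  have h2 := Real.log_two_gt_d9
  have h6 : 1 ≤ Real.log 6 := by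
    have : Real.log ((2 : ℝ) ^ 2) ≤ Real.log 6 := Real.log_le_log (by norm_num) (by norm_num)
    rw [Real.log_pow] at this
    norm_num at this
    linarith
  have hk0 := Real.log_nonneg hk'
  rw [hlog]
  refine ⟨by linarith, ?_⟩
  rcases Nat.lt_or_ge 1 k with h | h
  · have hlt : 2 ^ (Nat.clog 2 k).pred < k := Nat.pow_pred_clog_lt_self one_lt_two h
    have hle : Real.log ((2 : ℝ) ^ (Nat.clog 2 k).pred) ≤ Real.log k :=
      Real.log_le_log (by positivity) (by exact_mod_cast hlt.le)
    rw [Real.log_pow] at hle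
    have hp : (Nat.clog 2 k : ℝ) ≤ (Nat.clog 2 k).pred + 1 := by
      exact_mod_cast (show Nat.clog 2 k ≤ (Nat.clog 2 k).pred + 1 by rw [Nat.pred_eq_sub_one]; omega)
    have h0 : (0 : ℝ) ≤ ((Nat.clog 2 k).pred : ℝ) := by positivity
    -- `2 * log 2 > 1` makes `pred ≤ 2 * log k`, and `log 6 ≥ 1` absorbs the remaining `1`.
    nlinarith
  · rw [Nat.clog_of_right_le_one h, Nat.cast_zero]
    linarith

end Oracle

end FourierOracle

theorem mainTheorem9 :
    ∃ (C : ℝ) (p : ℕ), ∀ k B b₁ b₂ : ℕ, 1 ≤ k → 1 ≤ B → b₁ + b₂ = B →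
      ∃ T : ℕ, FourierOracle.OracleHasCost b₁ b₂ k T ∧
        (T : ℝ) ≤ C * (B * Real.log (FourierOracle.numFeatures k) ^ p) := by
  -- With `n = ⌈log₂ k⌉`, the cost is at most `2 + 27 n + 48 n² + 12 n B`, and `2 + 27 + 48 + 12 =
  -- 89`; the `n` ancillas raise `26 n` to `27 n`.
  refine ⟨89, 2, fun k B b₁ b₂ hk hB hb => ?_⟩
  obtain ⟨U, hU, hl⟩ := FourierOracle.exists_oracle_circuit (b₁ := b₁) (b₂ := b₂) hk
  refine ⟨U.length + Nat.clog 2 k, ⟨_, U, hU, rfl⟩, ?_⟩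
  obtain ⟨hL, hn⟩ := FourierOracle.clog_le_log_numFeatures hk
  rw [hb] at hl
  set L := Real.log (FourierOracle.numFeatures k)
  generalize Nat.clog 2 k = n at *
  have hl' : (U.length : ℝ) ≤ 2 + 2 * (n * (13 + 24 * n)) + 12 * (n * B) := by exact_mod_cast hl
  have hB' : (1 : ℝ) ≤ B := by exact_mod_cast hB
  have hn0 : (0 : ℝ) ≤ n := Nat.cast_nonneg n
  have hL2 : L ≤ L ^ 2 := by nlinarith
  have hnn : (n : ℝ) ^ 2 ≤ L ^ 2 := pow_le_pow_left₀ hn0 hn 2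
  have hBL : L ^ 2 ≤ B * L ^ 2 := le_mul_of_one_le_left (by positivity) hB'
  have hnB : (n : ℝ) * B ≤ B * L ^ 2 := by
    rw [mul_comm]
    exact mul_le_mul_of_nonneg_left (hn.trans hL2) (by positivity)
  push_cast
  nlinarith
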